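/- Let $d,m\ge 0$ be integers and let $\mathbb H[x_1,\dots,x_d]$ be the ring of quaternionic polynomials in $d$ central variables. For $f=\sum c_{i_1,\dots,i_d}x_1^{i_1}\cdots x_d^{i_d}$ and $a\in\mathbb H^d$ put $f(a)=\sum c_{i_1,\dots,i_d}a_1^{i_1}\cdots a_d^{i_d}$. A point $a\in\mathbb H^d$ is called good if $a_ia_j=a_ja_i$ for all $i,j$. Every element of $\mathbb H[x_1,\dots,x_d]$ is uniquely of the form $p+\mathbf j q$ with $p,q\in\mathbb C[x_1,\dots,x_d]$; writing $\bar p$ for the polynomial obtained from $p$ by conjugating its coefficients, let $$\varphi:\mathbb H[x_1,\dots,x_d]\to M_2(\mathbb C[x_1,\dots,x_d]),\qquad \varphi(p+\mathbf j q)=\begin{bmatrix}p&-\bar q\\ q&\bar p\end{bmatrix},$$ which is a ring homomorphism. A left ideal $J$ of a unital ring $A$ is called semiprime if for every $a\in A$ with $aAa\subseteq J$ we have $a\in J$. Theorem 6.3. Let $g_1,\dots,g_m\in\mathbb H[x_1,\dots,x_d]$, let $I$ be the left ideal of $\mathbb H[x_1,\dots,x_d]$ generated by $g_1,\dots,g_m$,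 and let $I'$ be the left ideal of $M_2(\mathbb C[x_1,\dots,x_d])$ generated by $\varphi(g_1),\dots,\varphi(g_m)$. For every $f\in\mathbb H[x_1,\dots,x_d]$ the following are equivalent. 1. For every good point $a\in\mathbb H^d$ such that $g_1(a)=\dots=g_m(a)=0$ we have $f(a)=0$. 2. For every $c\in\mathbb C^d$ and $u,v\in\mathbb C$ such that $\varphi(g_i)(c)\begin{bmatrix}u\\v\end{bmatrix}=0$ for $i=1,\dots,m$ we have $\varphi(f)(c)\begin{bmatrix}u\\v\end{bmatrix}=0$. 3. $\varphi(f)$ belongs to the smallest semiprime left ideal of $M_2(\mathbb C[x_1,\dots,x_d])$ containing $I'$. 4. $f$ belongs to the smallest semiprime left ideal of $\mathbb H[x_1,\dots,x_d]$ containing $I$. 5. For every $A\in M_2(\mathbb C)$ there exists an integer $N\ge 0$ such that $(A\varphi(f))^N\in I'+I'(A\varphi(f))+\dots+I'(A\varphi(f))^N$. 6. For every $b\in\mathbb H$ there exists an integer $N\ge 0$ such that $(bf)^N\in I+I(bf)+\dots+I(bf)^N$. -/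

import Mathlib

/-- A left ideal `I` of a (possibly noncommutative) unital ring `A` is semiprime if
`a A a ⊆ I` implies `a ∈ I`. (For a noncommutative ring, Mathlib's `Ideal A` is the type of
left ideals.) -/
def IsSemiprimeLeftIdeal {A : Type*} [Ring A] (I : Ideal A) : Prop :=
  ∀ a : A, (∀ x : A, a * x * a ∈ I) → a ∈ I

/-- The smallest semiprime left ideal containing `I`, i.e. the intersection of all semiprime
left ideals containing `I`; see `isLeast_semiprimeClosure`. -/
def semiprimeClosure {A : Type*} [Ring A] (I : Ideal A) : Ideal A :=
  sInf {J : Ideal A | I ≤ J ∧ IsSemiprimeLeftIdeal J}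

theorem isLeast_semiprimeClosure {A : Type*} [Ring A] (I : Ideal A) :
    IsLeast {J : Ideal A | I ≤ J ∧ IsSemiprimeLeftIdeal J} (semiprimeClosure I) := by
  refine ⟨⟨le_sInf fun J hJ => hJ.1, fun a ha => ?_⟩, fun J hJ => sInf_le hJ⟩
  rw [semiprimeClosure, Submodule.mem_sInf]
  intro J hJ
  exact hJ.2 a fun x => (Submodule.mem_sInf.1 (ha x)) J hJ

/-- The subset `I + I x + ⋯ + I x ^ N` of the ring `A`, for a left ideal `I` and `x : A`. -/
def idealPowerSum {A : Type*} [Ring A] (I : Ideal A) (x : A) (N : ℕ) : Set A :=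
  {y | ∃ h : ℕ → A, (∀ k, h k ∈ I) ∧ y = ∑ k ∈ Finset.range (N + 1), h k * x ^ k}

/-- The ring `ℍ[x₁, …, x_d]` of quaternionic polynomials in `d` central variables:
finite formal sums `∑ c_I x^I` with `c_I ∈ ℍ`, where the monomials `x^I` are central. -/
abbrev QuatPoly (d : ℕ) : Type := AddMonoidAlgebra (Quaternion ℝ) (Fin d →₀ ℕ)

/-- The value `f(a) = ∑ c_I a₁ ^ i₁ ⋯ a_d ^ i_d` of a quaternionic polynomial, with the
coefficients on the left and the powers multiplied in the order of the variables. -/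
noncomputable def quatEval {d : ℕ} (a : Fin d → Quaternion ℝ) (f : QuatPoly d) : Quaternion ℝ :=
  f.coeff.sum fun I c => c * (List.ofFn fun i => a i ^ I i).prod

/-- A point of `ℍ^d` is good if its components commute pairwise. -/
def IsGoodPoint {d : ℕ} (a : Fin d → Quaternion ℝ) : Prop :=
  ∀ i j, a i * a j = a j * a i

/-- The complex number `p` in the decomposition `c = p + 𝐣 q` of a quaternion. -/
def quatFst : Quaternion ℝ →+ ℂ where
  toFun c := ⟨c.re, c.imI⟩
  map_zero' := by apply Complex.ext <;> simp <;> rfl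
  map_add' x y := by apply Complex.ext <;> simp

/-- The complex number `q` in the decomposition `c = p + 𝐣 q` of a quaternion; note that
`𝐣 (s + t 𝐢) = s 𝐣 - t 𝐤`. -/
def quatSnd : Quaternion ℝ →+ ℂ where
  toFun c := ⟨c.imJ, -c.imK⟩
  map_zero' := by apply Complex.ext <;> simp <;> rfl
  map_add' x y := by apply Complex.ext <;> simp [add_comm]

/-- The quaternion unit `𝐣`. -/
def quatJ : Quaternion ℝ := ⟨0, 0, 1, 0⟩

theorem quat_eq_fst_add_j_mul_snd (c : Quaternion ℝ) :
    c = (quatFst c : Quaternion ℝ) + quatJ * (quatSnd c : Quaternion ℝ) := by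
  have h0 : quatJ.re = 0 := rfl
  have h1 : quatJ.imI = 0 := rfl
  have h2 : quatJ.imJ = 1 := rfl
  have h3 : quatJ.imK = 0 := rfl
  ext <;> simp [quatFst, quatSnd, h0, h1, h2, h3]

/-- The polynomial `p` in the decomposition `f = p + 𝐣 q`, with `p, q ∈ ℂ[x₁, …, x_d]`. -/
noncomputable def polyFst {d : ℕ} (f : QuatPoly d) : MvPolynomial (Fin d) ℂ :=
  AddMonoidAlgebra.map quatFst f

/-- The polynomial `q` in the decomposition `f = p + 𝐣 q`, with `p, q ∈ ℂ[x₁, …, x_d]`. -/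
noncomputable def polySnd {d : ℕ} (f : QuatPoly d) : MvPolynomial (Fin d) ℂ :=
  AddMonoidAlgebra.map quatSnd f

/-- Conjugation of all coefficients of a complex polynomial. -/
noncomputable def polyConj {d : ℕ} : MvPolynomial (Fin d) ℂ →+* MvPolynomial (Fin d) ℂ :=
  MvPolynomial.map (starRingEnd ℂ)

theorem polyFst_add {d : ℕ} (f g : QuatPoly d) : polyFst (f + g) = polyFst f + polyFst g :=
  AddMonoidAlgebra.map_add _ _ _

theorem polySnd_add {d : ℕ} (f g : QuatPoly d) : polySnd (f + g) = polySnd f + polySnd g :=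
  AddMonoidAlgebra.map_add _ _ _

theorem polyFst_zero {d : ℕ} : polyFst (0 : QuatPoly d) = 0 :=
  AddMonoidAlgebra.map_zero _

theorem polySnd_zero {d : ℕ} : polySnd (0 : QuatPoly d) = 0 :=
  AddMonoidAlgebra.map_zero _

theorem polyFst_single {d : ℕ} (m : Fin d →₀ ℕ) (c : Quaternion ℝ) :
    polyFst (AddMonoidAlgebra.single m c) = MvPolynomial.monomial m (quatFst c) :=
  AddMonoidAlgebra.map_single _ _ _

theorem polySnd_single {d : ℕ} (m : Fin d →₀ ℕ) (c : Quaternion ℝ) :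
    polySnd (AddMonoidAlgebra.single m c) = MvPolynomial.monomial m (quatSnd c) :=
  AddMonoidAlgebra.map_single _ _ _

theorem quatFst_mul (x y : Quaternion ℝ) :
    quatFst (x * y) = quatFst x * quatFst y - starRingEnd ℂ (quatSnd x) * quatSnd y := by
  apply Complex.ext <;> simp [quatFst, quatSnd] <;> ring

theorem quatSnd_mul (x y : Quaternion ℝ) :
    quatSnd (x * y) = quatSnd x * quatFst y + starRingEnd ℂ (quatFst x) * quatSnd y := by
  apply Complex.ext <;> simp [quatFst, quatSnd] <;> ring

theorem polyFst_mul {d : ℕ} (f g : QuatPoly d) :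
    polyFst (f * g) = polyFst f * polyFst g - polyConj (polySnd f) * polySnd g := by
  induction f using AddMonoidAlgebra.induction_linear with
  | zero => simp [polyFst_zero, polySnd_zero]
  | add f₁ f₂ h₁ h₂ => rw [add_mul, polyFst_add, h₁, h₂, polyFst_add, polySnd_add, map_add]; ring
  | single m c =>
    induction g using AddMonoidAlgebra.induction_linear with
    | zero => simp [polyFst_zero, polySnd_zero]
    | add f₁ f₂ h₁ h₂ => rw [mul_add, polyFst_add, h₁, h₂, polyFst_add, polySnd_add]; ring
    | single n e =>
      rw [AddMonoidAlgebra.single_mul_single]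
      simp only [polyFst_single, polySnd_single, polyConj, MvPolynomial.map_monomial,
        MvPolynomial.monomial_mul, quatFst_mul, map_sub]

theorem polySnd_mul {d : ℕ} (f g : QuatPoly d) :
    polySnd (f * g) = polySnd f * polyFst g + polyConj (polyFst f) * polySnd g := by
  induction f using AddMonoidAlgebra.induction_linear with
  | zero => simp [polyFst_zero, polySnd_zero]
  | add f₁ f₂ h₁ h₂ => rw [add_mul, polySnd_add, h₁, h₂, polyFst_add, polySnd_add, map_add]; ring
  | single m c =>
    induction g using AddMonoidAlgebra.induction_linear with
    | zero => simp [polyFst_zero, polySnd_zero]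
    | add f₁ f₂ h₁ h₂ => rw [mul_add, polySnd_add, h₁, h₂, polyFst_add, polySnd_add]; ring
    | single n e =>
      rw [AddMonoidAlgebra.single_mul_single]
      simp only [polyFst_single, polySnd_single, polyConj, MvPolynomial.map_monomial,
        MvPolynomial.monomial_mul, quatSnd_mul, map_add]

theorem polyConj_polyConj {d : ℕ} (p : MvPolynomial (Fin d) ℂ) : polyConj (polyConj p) = p := by
  have h : (starRingEnd ℂ).comp (starRingEnd ℂ) = RingHom.id ℂ := by ext z; simp
  rw [polyConj, MvPolynomial.map_map, h, MvPolynomial.map_id]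

theorem polyFst_one {d : ℕ} : polyFst (1 : QuatPoly d) = 1 := by
  rw [AddMonoidAlgebra.one_def, polyFst_single]
  have h : quatFst 1 = 1 := by apply Complex.ext <;> simp [quatFst] <;> rfl
  rw [h]; rfl

theorem polySnd_one {d : ℕ} : polySnd (1 : QuatPoly d) = 0 := by
  rw [AddMonoidAlgebra.one_def, polySnd_single]
  have h : quatSnd 1 = 0 := by apply Complex.ext <;> simp [quatSnd] <;> rfl
  rw [h, map_zero]

/-- The embedding `φ : ℍ[x₁, …, x_d] → M₂(ℂ[x₁, …, x_d])`, a ring homomorphism, given by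
`φ(p + 𝐣 q) = [[p, -q̄], [q, p̄]]`. -/
noncomputable def quatEmbed (d : ℕ) :
    QuatPoly d →+* Matrix (Fin 2) (Fin 2) (MvPolynomial (Fin d) ℂ) where
  toFun f := !![polyFst f, -polyConj (polySnd f); polySnd f, polyConj (polyFst f)]
  map_one' := by
    ext i j; fin_cases i <;> fin_cases j <;> simp [polyFst_one, polySnd_one]
  map_mul' f g := by
    rw [Matrix.mul_fin_two]
    simp only [polyFst_mul, polySnd_mul, map_sub, map_add, map_mul, polyConj_polyConj]
    ext i j; fin_cases i <;> fin_cases j <;> simp <;> ring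
  map_zero' := by
    ext i j; fin_cases i <;> fin_cases j <;> simp [polyFst_zero, polySnd_zero]
  map_add' f g := by
    ext i j; fin_cases i <;> fin_cases j <;> simp [polyFst_add, polySnd_add, add_comm]

/-- The value `F(c) ∈ M₂(ℂ)` of a matrix polynomial at a point `c ∈ ℂ^d`. -/
noncomputable def matEval {d : ℕ} (c : Fin d → ℂ)
    (F : Matrix (Fin 2) (Fin 2) (MvPolynomial (Fin d) ℂ)) : Matrix (Fin 2) (Fin 2) ℂ :=
  F.map (MvPolynomial.eval c)

/-- A constant complex matrix regarded as a matrix polynomial. -/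
noncomputable def matConst {d : ℕ} (A : Matrix (Fin 2) (Fin 2) ℂ) :
    Matrix (Fin 2) (Fin 2) (MvPolynomial (Fin d) ℂ) :=
  A.map MvPolynomial.C

/-- A quaternion regarded as a constant quaternionic polynomial. -/
noncomputable def quatConst {d : ℕ} (b : Quaternion ℝ) : QuatPoly d :=
  AddMonoidAlgebra.single 0 b

/-! The implications run 1 → 2 → 4 → 1, then 4 → 3 → 2, and 2 → 5 → 6 → 1. Identify `ℍ` with the
right complex space `ℂ ⊕ 𝐣ℂ`. Then `φ` is left multiplication, and for `w = u + 𝐣v ≠ 0` the good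
point `a = w c w⁻¹` satisfies `f(a) w = φ(f)(c) (u, v)` in coordinates. This gives 1 → 2. Vanishing
at a good point, or of `F(c) w` for a matrix polynomial `F`, defines a semiprime left ideal, whence
4 → 1 and 3 → 2. The algebra `M₂(ℂ[x])` is the complexification of `ℍ[x]`, so semiprime ideals
contract along `φ` (4 → 3), and projection onto `ℍ[x]` turns power relations for matrices into
quaternionic ones (5 → 6). Evaluation at a good point sends suitably scaled powers to `1`, which
gives 6 → 1. The core of 2 → 4 is `exists_prime_separating`: if `f` lies outside a semiprime left
ideal `J` of quaternions over a Noetherian ring `R`, some prime `𝔭` of `R` and some `y` satisfy `J y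
⊆ 𝔭ℍ` and `f y ∉ 𝔭ℍ`. With `R = ℝ[x]`, the Nullstellensatz gives a complex zero `c` of `𝔭` with `φ(f
y)(c) ≠ 0`; the columns of `φ(y)(c)` are killed by every `φ(g)(c)`, `g ∈ J`, but not all by
`φ(f)(c)`. For 2 → 5 an indeterminate `X` is adjoined to stand for an eigenvalue of `F = A φ(f)`: a
nonzero eigenvalue on a common kernel vector of `I'` is the only obstruction to a power of `X` lying
in the left ideal generated by `I'` and `X - F`. -/

/-! ### Semiprime left ideals of quaternions over a commutative ring -/

section QuaternionCore

open scoped Quaternion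

variable {R : Type*} [CommRing R]

/-- The ideal of quaternions over `R` whose components all lie in the ideal `𝔭` of `R`. -/
def quatExtend (𝔭 : Ideal R) : Ideal ℍ[R] where
  carrier := {x | x.re ∈ 𝔭 ∧ x.imI ∈ 𝔭 ∧ x.imJ ∈ 𝔭 ∧ x.imK ∈ 𝔭}
  zero_mem' := ⟨𝔭.zero_mem, 𝔭.zero_mem, 𝔭.zero_mem, 𝔭.zero_mem⟩
  add_mem' := fun ⟨a, b, c, d⟩ ⟨a', b', c', d'⟩ =>
    ⟨𝔭.add_mem a a', 𝔭.add_mem b b', 𝔭.add_mem c c', 𝔭.add_mem d d'⟩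
  smul_mem' := by
    rintro y x ⟨a, b, c, d⟩
    simp only [smul_eq_mul, Set.mem_ofPred_eq, Quaternion.re_mul, Quaternion.imI_mul,
      Quaternion.imJ_mul, Quaternion.imK_mul]
    have h := fun r : R => 𝔭.mul_mem_left r a
    have hb := fun r : R => 𝔭.mul_mem_left r b
    have hc := fun r : R => 𝔭.mul_mem_left r c
    have hd := fun r : R => 𝔭.mul_mem_left r d
    exact ⟨sub_mem (sub_mem (sub_mem (h _) (hb _)) (hc _)) (hd _),
      sub_mem (add_mem (add_mem (hb _) (h _)) (hd _)) (hc _),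
      add_mem (add_mem (sub_mem (hc _) (hd _)) (h _)) (hb _),
      add_mem (sub_mem (add_mem (hd _) (hc _)) (hb _)) (h _)⟩

theorem mem_quatExtend {𝔭 : Ideal R} {x : ℍ[R]} :
    x ∈ quatExtend 𝔭 ↔ x.re ∈ 𝔭 ∧ x.imI ∈ 𝔭 ∧ x.imJ ∈ 𝔭 ∧ x.imK ∈ 𝔭 := Iff.rfl

theorem star_mem_quatExtend {𝔭 : Ideal R} {x : ℍ[R]} (hx : x ∈ quatExtend 𝔭) :
    star x ∈ quatExtend 𝔭 := by
  obtain ⟨a, b, c, d⟩ := hx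
  exact ⟨by simpa using a, neg_mem b, neg_mem c, neg_mem d⟩

theorem mul_mem_quatExtend_right {𝔭 : Ideal R} {x : ℍ[R]} (hx : x ∈ quatExtend 𝔭) (y : ℍ[R]) :
    x * y ∈ quatExtend 𝔭 := by
  simpa using star_mem_quatExtend ((quatExtend 𝔭).mul_mem_left (star y) (star_mem_quatExtend hx))

/-- The quaternion with the given components. -/
def quatMk (a b c d : R) : ℍ[R] := ⟨a, b, c, d⟩

@[simp] theorem re_quatMk (a b c d : R) : (quatMk a b c d).re = a := rfl
@[simp] theorem imI_quatMk (a b c d : R) : (quatMk a b c d).imI = b := rfl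
@[simp] theorem imJ_quatMk (a b c d : R) : (quatMk a b c d).imJ = c := rfl
@[simp] theorem imK_quatMk (a b c d : R) : (quatMk a b c d).imK = d := rfl

/-- The trace form is nondegenerate modulo every ideal. -/
theorem mem_quatExtend_of_forall_re_mul {𝔭 : Ideal R} {x : ℍ[R]}
    (h : ∀ a : ℍ[R], (a * x).re ∈ 𝔭) : x ∈ quatExtend 𝔭 := by
  have h0 := h (quatMk 1 0 0 0)
  have h1 := h (quatMk 0 1 0 0)
  have h2 := h (quatMk 0 0 1 0)
  have h3 := h (quatMk 0 0 0 1)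
  simp only [Quaternion.re_mul, re_quatMk, imI_quatMk, imJ_quatMk, imK_quatMk,
    one_mul, zero_mul, sub_zero, zero_sub, neg_mem_iff] at h0 h1 h2 h3
  exact ⟨h0, h1, h2, h3⟩

theorem quat_smul_mul_mem (J : Ideal ℍ[R]) {r : R} {t : ℍ[R]} (h : r • t ∈ J) (x : ℍ[R]) :
    r • (x * t) ∈ J := by
  have := J.mul_mem_left x h
  rwa [mul_smul_comm] at this

theorem mul_mem_of_mem_quatExtend {𝔭 : Ideal R} {J : Ideal ℍ[R]} {t : ℍ[R]}
    (ht : ∀ r ∈ 𝔭, r • t ∈ J) {p : ℍ[R]} (hp : p ∈ quatExtend 𝔭) : p * t ∈ J := by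
  have hp' : p * t = p.re • t + p.imI • (quatMk 0 1 0 0 * t) +
      p.imJ • (quatMk 0 0 1 0 * t) + p.imK • (quatMk 0 0 0 1 * t) := by
    simp only [← smul_mul_assoc]
    rw [← Quaternion.coe_mul_eq_smul p.re, ← add_mul, ← add_mul, ← add_mul]
    congr 1
    ext <;> simp
  rw [hp']
  exact J.add_mem (J.add_mem (J.add_mem (ht _ hp.1) (quat_smul_mul_mem J (ht _ hp.2.1) _))
    (quat_smul_mul_mem J (ht _ hp.2.2.1) _)) (quat_smul_mul_mem J (ht _ hp.2.2.2) _)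

/-- The ideal of scalars `r` with `r • t ∈ J`. -/
def scalarColon (J : Ideal ℍ[R]) (t : ℍ[R]) : Ideal R where
  carrier := {r | r • t ∈ J}
  zero_mem' := by simp
  add_mem' := fun {a b} ha hb => by
    have := J.add_mem ha hb
    rwa [← add_smul] at this
  smul_mem' := fun c r hr => by
    have := quat_smul_mul_mem J (t := t) hr (c : ℍ[R])
    rw [Quaternion.coe_mul_eq_smul, smul_smul, mul_comm] at this
    exact this

theorem mem_scalarColon {J : Ideal ℍ[R]} {t : ℍ[R]} {r : R} :
    r ∈ scalarColon J t ↔ r • t ∈ J := Iff.rfl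

theorem smul_mem_quat (J : Ideal ℍ[R]) (r : R) {x : ℍ[R]} (hx : x ∈ J) : r • x ∈ J := by
  rw [← Quaternion.coe_mul_eq_smul]
  exact J.mul_mem_left _ hx

/-- An element outside a semiprime left ideal `J` has a central multiple `r • f` whose
annihilator modulo `J` is a prime `𝔭` with `r • f` nonzero modulo `𝔭`. -/
theorem exists_prime_scalarColon [IsNoetherianRing R] {J : Ideal ℍ[R]}
    (hJ : IsSemiprimeLeftIdeal J) {f : ℍ[R]} (hf : f ∉ J) :
    ∃ r : R, (scalarColon J (r • f)).IsPrime ∧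
      r • f ∉ quatExtend (scalarColon J (r • f)) := by
  -- A maximal member of this family is prime: for `a` outside it, the ideal attached to `a * r`
  -- contains it, hence equals it.
  have hne : {𝔞 : Ideal R | ∃ r : R, 𝔞 = scalarColon J (r • f) ∧ r • f ∉ J}.Nonempty :=
    ⟨_, 1, rfl, by rwa [one_smul]⟩
  obtain ⟨𝔭, ⟨r, rfl, hr⟩, hmax⟩ :=
    set_has_maximal_iff_noetherian.2 (inferInstance : IsNoetherian R R) _ hne
  refine ⟨r, ⟨fun h => hr ?_, fun {a b} hab => or_iff_not_imp_left.2 fun ha => ?_⟩, fun h => hr ?_⟩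
  · have : (1 : R) ∈ scalarColon J (r • f) := h ▸ Submodule.mem_top
    rwa [mem_scalarColon, one_smul] at this
  · by_contra hb
    refine hmax (scalarColon J ((a * r) • f)) ⟨a * r, rfl, ?_⟩ (lt_of_le_not_ge ?_ fun h => hb (h ?_))
    · rwa [mem_scalarColon, smul_smul] at ha
    · intro x hx
      have := smul_mem_quat J a (mem_scalarColon.1 hx)
      rw [smul_comm, smul_smul a] at this
      exact this
    · rw [mem_scalarColon] at hab ⊢
      rwa [smul_smul, ← mul_assoc, mul_comm b a, ← smul_smul]
  -- If `t = r • f` had components in `𝔭`, then so would `t x`, and `𝔭 t ⊆ J` would give `t x t ∈ J`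
  -- for all `x`.
  · exact hJ _ fun x => mul_mem_of_mem_quatExtend (fun _ h => h) (mul_mem_quatExtend_right h x)

/-- Semiprime left ideals of quaternions over a Noetherian ring are detected by right
multiplication into the quaternions over a residue domain. -/
theorem exists_prime_separating [IsNoetherianRing R] (h2 : IsUnit (2 : R)) {J : Ideal ℍ[R]}
    (hJ : IsSemiprimeLeftIdeal J) {f : ℍ[R]} (hf : f ∉ J) :
    ∃ (𝔭 : Ideal R) (y : ℍ[R]), 𝔭.IsPrime ∧ (∀ x ∈ J, x * y ∈ quatExtend 𝔭) ∧
      f * y ∉ quatExtend 𝔭 := by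
  obtain ⟨r, hp, ht⟩ := exists_prime_scalarColon hJ hf
  set t := r • f with ht_def
  set 𝔭 := scalarColon J t with h𝔭
  have hty : ∀ y, t * y ∉ quatExtend 𝔭 → f * y ∉ quatExtend 𝔭 := fun y hy h => hy <| by
    rw [ht_def, smul_mul_assoc]
    exact smul_mem_quat _ r h
  -- Modulo `𝔭ℍ`, a multiple `q t` can agree with an element of `J` only if `q ∈ 𝔭`: the difference
  -- `x` satisfies `x y x ∈ J` for all `y`, so `x ∈ J` and `q t ∈ J`.
  have key : ∀ (q : R) (n : ℍ[R]), n ∈ J → q • t - n ∈ quatExtend 𝔭 → q ∈ 𝔭 := by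
    intro q n hn hx
    set x := q • t - n with hx_def
    have hxJ : x ∈ J := hJ _ fun y => by
      have h1 : x * y * x = q • (x * y * t) - x * y * n := by
        conv_lhs => rw [hx_def]
        rw [← hx_def, mul_sub, mul_smul_comm]
      rw [h1]
      exact J.sub_mem (smul_mem_quat J q (mul_mem_of_mem_quatExtend (fun _ h => h)
        (mul_mem_quatExtend_right hx y))) (J.mul_mem_left _ hn)
    have := J.add_mem hxJ hn
    rwa [hx_def, sub_add_cancel] at this
  by_cases hJ𝔭 : J ≤ quatExtend 𝔭
  · exact ⟨𝔭, 1, hp, fun x hx => by simpa using hJ𝔭 hx, hty 1 (by simpa using ht)⟩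
  obtain ⟨n, hn, hn𝔭⟩ := SetLike.not_le_iff_exists.1 hJ𝔭
  -- `N(z) t = t z̄ z` lies in `J`, so `key` applies with zero difference.
  have hnorm : ∀ z ∈ J, Quaternion.normSq z ∈ 𝔭 := fun z hz => by
    refine key _ (t * (star z * z)) (J.mul_mem_left _ (J.mul_mem_left _ hz)) ?_
    rw [Quaternion.star_mul_self, Quaternion.mul_coe_eq_smul, sub_self]
    exact zero_mem _
  have htwo : ∀ x : R, 2 * x ∈ 𝔭 → x ∈ 𝔭 := fun x hx =>
    (hp.mem_or_mem hx).resolve_left fun h => hp.ne_top (𝔭.eq_top_of_isUnit_mem h h2)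
  -- The norm takes values in `𝔭` on `J`; polarizing at `a x` and `n` gives `2 Re(a x n̄) ∈ 𝔭` for
  -- all `a`, hence `x n̄ ∈ 𝔭ℍ`.
  refine ⟨𝔭, star n, hp, fun x hx => mem_quatExtend_of_forall_re_mul fun a => htwo _ ?_,
    hty _ fun h => hn𝔭 (mem_quatExtend_of_forall_re_mul fun a => htwo _ ?_)⟩
  · have hax := J.mul_mem_left a hx
    have := Quaternion.normSq_add (a * x) n
    rw [mul_assoc] at this
    have h3 := sub_mem (hnorm _ (J.add_mem hax hn)) (add_mem (hnorm _ hax) (hnorm _ hn))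
    rw [this, add_sub_cancel_left] at h3
    exact h3
  -- If `t n̄ ∈ 𝔭ℍ`, then `2 Re(a n) t` agrees modulo `𝔭ℍ` with `t a n ∈ J`, which forces `n ∈ 𝔭ℍ`.
  · refine key _ (t * (a * n)) (J.mul_mem_left _ (J.mul_mem_left _ hn)) ?_
    have : (2 * (a * n).re) • t - t * (a * n) = t * star n * star a := by
      rw [← Quaternion.mul_coe_eq_smul, ← Quaternion.self_add_star', mul_add, add_sub_cancel_left,
        star_mul, mul_assoc]
    rw [this]
    exact mul_mem_quatExtend_right h _

end QuaternionCore

/-! ### Points of zero loci and common kernels of singular matrices -/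

/-- Weak Nullstellensatz: an element outside the radical of an ideal of a finitely generated
algebra is nonzero at some point of the zero locus of the ideal. -/
theorem exists_algHom_of_notMem_radical {k K S : Type*} [Field k] [Field K] [Algebra k K]
    [IsAlgClosed K] [CommRing S] [Algebra k S] [Algebra.FiniteType k S] {𝔞 : Ideal S} {x : S}
    (hx : x ∉ 𝔞.radical) : ∃ χ : S →ₐ[k] K, (∀ a ∈ 𝔞, χ a = 0) ∧ χ x ≠ 0 := by
  -- Inverting `x` in `S ⧸ 𝔞` leaves a nonzero ring, since `x` is not nilpotent there; its residue
  -- fields are finite over `k` by Zariski's lemma and so embed in `K`.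
  let T := Localization.Away (Ideal.Quotient.mk 𝔞 x)
  have : Algebra.FiniteType (S ⧸ 𝔞) T :=
    IsLocalization.finiteType_of_monoid_fg (Submonoid.powers (Ideal.Quotient.mk 𝔞 x)) T
  have : Algebra.FiniteType k T := Algebra.FiniteType.trans (S := S ⧸ 𝔞) inferInstance this
  have : Nontrivial T := by
    rw [← not_subsingleton_iff_nontrivial,
      IsLocalization.subsingleton_iff (M := Submonoid.powers (Ideal.Quotient.mk 𝔞 x))]
    rintro ⟨n, hn⟩
    refine hx ⟨n, Ideal.Quotient.eq_zero_iff_mem.1 ?_⟩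
    simpa using hn
  obtain ⟨M, hM⟩ := Ideal.exists_maximal T
  let : Field (T ⧸ M) := Ideal.Quotient.field M
  have : Module.Finite k (T ⧸ M) := finite_of_finite_type_of_isJacobsonRing k (T ⧸ M)
  have : Module.IsTorsionFree k (T ⧸ M) := Module.Free.instIsTorsionFree _ _
  let ι : T ⧸ M →ₐ[k] K := IsAlgClosed.lift
  let χ : S →ₐ[k] K := (ι.comp (Ideal.Quotient.mkₐ k M)).comp
    ((IsScalarTower.toAlgHom k (S ⧸ 𝔞) T).comp (Ideal.Quotient.mkₐ k 𝔞))
  refine ⟨χ, fun a ha => ?_, ?_⟩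
  · have : Ideal.Quotient.mk 𝔞 a = 0 := Ideal.Quotient.eq_zero_iff_mem.2 ha
    simp [χ, this]
  · have hu : IsUnit (algebraMap (S ⧸ 𝔞) T (Ideal.Quotient.mk 𝔞 x)) :=
      IsLocalization.map_units T (⟨_, Submonoid.mem_powers _⟩ : Submonoid.powers _)
    exact ((hu.map (ι.comp (Ideal.Quotient.mkₐ k M)))).ne_zero

/-- A left ideal of singular `2 × 2` matrices over a field has a common kernel vector. -/
theorem exists_common_kernel_vector {K : Type*} [Field K] (L : Ideal (Matrix (Fin 2) (Fin 2) K))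
    (hL : ∀ z ∈ L, z.det = 0) : ∃ w : Fin 2 → K, w ≠ 0 ∧ ∀ z ∈ L, z.mulVec w = 0 := by
  by_cases h : ∃ n ∈ L, ∃ i j, n i j ≠ 0
  · obtain ⟨n, hn, i, j, hij⟩ := h
    -- The vector orthogonal to a nonzero row of `n`.
    refine ⟨![-n i 1, n i 0], fun h0 => ?_, fun z hz => ?_⟩
    · have h1 := congrFun h0 0
      have h2 := congrFun h0 1
      fin_cases j
      · exact hij (by simpa using h2)
      · exact hij (by simpa using h1)
    · ext k
      -- This element of `L` has row `i` of `n` above row `k` of `z`, so its determinant is the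
      -- pairing of row `k` of `z` with the chosen vector.
      have hd := hL _ (L.add_mem (L.mul_mem_left (Matrix.single 0 i 1) hn)
        (L.mul_mem_left (Matrix.single 1 k 1) hz))
      rw [Matrix.det_fin_two] at hd
      simp [Matrix.mul_apply, Matrix.single_apply] at hd
      simp [Matrix.mulVec, dotProduct, Fin.sum_univ_two]
      linear_combination hd
  · push Not at h
    refine ⟨![1, 0], by simp, fun z hz => ?_⟩
    have : z = 0 := by ext i j; exact h z hz i j
    rw [this, Matrix.zero_mulVec]

/-! ### Quaternionic polynomials as quaternions over real polynomials -/

section QuaternionPolynomials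

variable {d : ℕ}

/-- The real component of a quaternion. -/
def quatRe : Quaternion ℝ →+ ℝ := AddMonoidHom.mk' (fun c => c.re) fun _ _ => rfl
/-- The `𝐢`-component of a quaternion. -/
def quatImI : Quaternion ℝ →+ ℝ := AddMonoidHom.mk' (fun c => c.imI) fun _ _ => rfl
/-- The `𝐣`-component of a quaternion. -/
def quatImJ : Quaternion ℝ →+ ℝ := AddMonoidHom.mk' (fun c => c.imJ) fun _ _ => rfl
/-- The `𝐤`-component of a quaternion. -/
def quatImK : Quaternion ℝ →+ ℝ := AddMonoidHom.mk' (fun c => c.imK) fun _ _ => rfl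

/-- A quaternionic polynomial as a quaternion with real polynomial components. -/
noncomputable def quatPolyToQuat (f : QuatPoly d) : Quaternion (MvPolynomial (Fin d) ℝ) :=
  quatMk (AddMonoidAlgebra.map quatRe f) (AddMonoidAlgebra.map quatImI f)
    (AddMonoidAlgebra.map quatImJ f) (AddMonoidAlgebra.map quatImK f)

theorem quatPolyToQuat_add (f g : QuatPoly d) :
    quatPolyToQuat (f + g) = quatPolyToQuat f + quatPolyToQuat g := by
  ext1 <;> exact AddMonoidAlgebra.map_add _ _ _

theorem quatPolyToQuat_zero : quatPolyToQuat (0 : QuatPoly d) = 0 := by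
  ext1 <;> exact AddMonoidAlgebra.map_zero _

theorem quatPolyToQuat_single (m : Fin d →₀ ℕ) (c : Quaternion ℝ) :
    quatPolyToQuat (AddMonoidAlgebra.single m c) =
      quatMk (MvPolynomial.monomial m c.re) (MvPolynomial.monomial m c.imI)
        (MvPolynomial.monomial m c.imJ) (MvPolynomial.monomial m c.imK) := by
  ext1 <;> exact AddMonoidAlgebra.map_single _ _ _

theorem quatPolyToQuat_mul (f g : QuatPoly d) :
    quatPolyToQuat (f * g) = quatPolyToQuat f * quatPolyToQuat g := by
  induction f using AddMonoidAlgebra.induction_linear with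
  | zero => simp [quatPolyToQuat_zero]
  | add f₁ f₂ h₁ h₂ => rw [add_mul, quatPolyToQuat_add, h₁, h₂, quatPolyToQuat_add, add_mul]
  | single m c =>
    induction g using AddMonoidAlgebra.induction_linear with
    | zero => simp [quatPolyToQuat_zero]
    | add f₁ f₂ h₁ h₂ => rw [mul_add, quatPolyToQuat_add, h₁, h₂, quatPolyToQuat_add, mul_add]
    | single n e =>
      rw [AddMonoidAlgebra.single_mul_single]
      simp only [quatPolyToQuat_single]
      ext1 <;> simp [MvPolynomial.monomial_mul]

theorem quatPolyToQuat_injective : Function.Injective (quatPolyToQuat (d := d)) := by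
  intro f g h
  refine AddMonoidAlgebra.ext (Finsupp.ext fun m => ?_)
  ext
  · exact congrArg (fun p => MvPolynomial.coeff m p.re) h
  · exact congrArg (fun p => MvPolynomial.coeff m p.imI) h
  · exact congrArg (fun p => MvPolynomial.coeff m p.imJ) h
  · exact congrArg (fun p => MvPolynomial.coeff m p.imK) h

theorem quatPolyToQuat_surjective : Function.Surjective (quatPolyToQuat (d := d)) := by
  intro q
  let f : QuatPoly d := AddMonoidAlgebra.ofCoeff (Finsupp.onFinset
    (q.re.support ∪ q.imI.support ∪ q.imJ.support ∪ q.imK.support)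
    (fun m => quatMk (q.re.coeff m) (q.imI.coeff m) (q.imJ.coeff m) (q.imK.coeff m)) (by
      intro m hm
      contrapose! hm
      simp only [Finset.mem_union, MvPolynomial.mem_support_iff, not_or, not_not] at hm
      obtain ⟨⟨⟨h1, h2⟩, h3⟩, h4⟩ := hm
      rw [h1, h2, h3, h4]
      rfl))
  refine ⟨f, ?_⟩
  ext1 <;> exact MvPolynomial.ext _ _ fun m => rfl

/-- The ring isomorphism between quaternionic polynomials and quaternions over the ring of real
polynomials. -/
noncomputable def quatPolyEquiv (d : ℕ) : QuatPoly d ≃+* Quaternion (MvPolynomial (Fin d) ℝ) :=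
  { Equiv.ofBijective _ ⟨quatPolyToQuat_injective, quatPolyToQuat_surjective⟩ with
    map_mul' := quatPolyToQuat_mul
    map_add' := quatPolyToQuat_add }

theorem quatPolyEquiv_apply (f : QuatPoly d) : quatPolyEquiv d f = quatPolyToQuat f := rfl

theorem IsSemiprimeLeftIdeal.comap_equiv {A B : Type*} [Ring A] [Ring B] {J : Ideal A}
    (hJ : IsSemiprimeLeftIdeal J) (e : B ≃+* A) : IsSemiprimeLeftIdeal (J.comap e) := by
  intro b hb
  refine hJ (e b) fun x => ?_
  have := hb (e.symm x)
  rw [Ideal.mem_comap, map_mul, map_mul, e.apply_symm_apply] at this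
  exact this

/-- Evaluation at `c ∈ ℂ^d` of matrix polynomials, as a ring homomorphism. -/
noncomputable def matEvalHom (c : Fin d → ℂ) :
    Matrix (Fin 2) (Fin 2) (MvPolynomial (Fin d) ℂ) →+* Matrix (Fin 2) (Fin 2) ℂ :=
  (MvPolynomial.eval c).mapMatrix

theorem matEvalHom_apply (c : Fin d → ℂ) (F : Matrix (Fin 2) (Fin 2) (MvPolynomial (Fin d) ℂ)) :
    matEvalHom c F = matEval c F := rfl

theorem matEval_mul (c : Fin d → ℂ) (F G : Matrix (Fin 2) (Fin 2) (MvPolynomial (Fin d) ℂ)) :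
    matEval c (F * G) = matEval c F * matEval c G := map_mul (matEvalHom c) F G

theorem matEval_quatEmbed_eq (χ : MvPolynomial (Fin d) ℝ →ₐ[ℝ] ℂ) (f : QuatPoly d) :
    matEval (fun i => χ (MvPolynomial.X i)) (quatEmbed d f) =
      !![χ (quatPolyToQuat f).re + Complex.I * χ (quatPolyToQuat f).imI,
        -(χ (quatPolyToQuat f).imJ + Complex.I * χ (quatPolyToQuat f).imK);
        χ (quatPolyToQuat f).imJ - Complex.I * χ (quatPolyToQuat f).imK,
        χ (quatPolyToQuat f).re - Complex.I * χ (quatPolyToQuat f).imI] := by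
  induction f using AddMonoidAlgebra.induction_linear with
  | zero =>
    rw [map_zero, quatPolyToQuat_zero, ← matEvalHom_apply, map_zero]
    ext i j; fin_cases i <;> fin_cases j <;> simp [Quaternion.re_zero, Quaternion.imI_zero,
      Quaternion.imJ_zero, Quaternion.imK_zero]
  | add f g hf hg =>
    rw [map_add, quatPolyToQuat_add, ← matEvalHom_apply, map_add, matEvalHom_apply,
      matEvalHom_apply, hf, hg]
    ext i j; fin_cases i <;> fin_cases j <;> simp <;> ring
  | single m c =>
    have hχ : ∀ r : ℝ, χ (MvPolynomial.monomial m r) =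
        r * m.prod fun i k => χ (MvPolynomial.X i) ^ k := fun r => by
      rw [MvPolynomial.monomial_eq, map_mul, ← MvPolynomial.algebraMap_eq, χ.commutes,
        Finsupp.prod, map_prod, Finsupp.prod]
      simp
    have h1 : quatFst c = c.re + Complex.I * c.imI := by
      apply Complex.ext <;> simp [quatFst]
    have h2 : quatSnd c = c.imJ - Complex.I * c.imK := by
      apply Complex.ext <;> simp [quatSnd]
    simp only [quatPolyToQuat_single, re_quatMk, imI_quatMk, imJ_quatMk, imK_quatMk, hχ]
    ext i j; fin_cases i <;> fin_cases j <;>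
      simp [matEval, quatEmbed, polyFst_single, polySnd_single, polyConj, MvPolynomial.eval_monomial,
        h1, h2] <;> ring

theorem mem_semiprime_of_forall_matEval {m : ℕ} {g : Fin m → QuatPoly d} {f : QuatPoly d}
    (h : ∀ (c : Fin d → ℂ) (u v : ℂ),
      (∀ i, (matEval c (quatEmbed d (g i))).mulVec ![u, v] = 0) →
        (matEval c (quatEmbed d f)).mulVec ![u, v] = 0)
    {J : Ideal (QuatPoly d)} (hJ : IsSemiprimeLeftIdeal J) (hg : ∀ i, g i ∈ J) : f ∈ J := by
  by_contra hf
  have h2 : IsUnit (2 : MvPolynomial (Fin d) ℝ) := by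
    have := (isUnit_iff_ne_zero.2 (two_ne_zero (α := ℝ))).map
      (MvPolynomial.C (σ := Fin d) (R := ℝ))
    rwa [map_ofNat] at this
  obtain ⟨𝔭, y, h𝔭, hJy, hfy⟩ := exists_prime_separating h2
    (hJ.comap_equiv (quatPolyEquiv d).symm) (f := quatPolyEquiv d f) (by simpa using hf)
  obtain ⟨y, rfl⟩ := (quatPolyEquiv d).surjective y
  replace hJy : ∀ x ∈ J, quatPolyToQuat (x * y) ∈ quatExtend 𝔭 := fun x hx => by
    rw [quatPolyToQuat_mul]
    exact hJy (quatPolyEquiv d x) (by simpa using hx)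
  rw [← map_mul, quatPolyEquiv_apply] at hfy
  have hχ : ∃ χ : MvPolynomial (Fin d) ℝ →ₐ[ℝ] ℂ, (∀ a ∈ 𝔭, χ a = 0) ∧
      matEval (fun i => χ (MvPolynomial.X i)) (quatEmbed d (f * y)) ≠ 0 := by
    have hex : ∀ p ∉ 𝔭, ∃ χ : MvPolynomial (Fin d) ℝ →ₐ[ℝ] ℂ, (∀ a ∈ 𝔭, χ a = 0) ∧ χ p ≠ 0 :=
      fun p hp => exists_algHom_of_notMem_radical (by rwa [h𝔭.isRadical.radical])
    -- The entries of `φ(f y)` are invertible complex combinations of its four components. If all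
    -- these matrices vanished, the components would vanish at every complex zero of `𝔭` and so lie
    -- in `𝔭`.
    by_contra! hall
    have hI := Complex.I_ne_zero
    have hzero : ∀ χ : MvPolynomial (Fin d) ℝ →ₐ[ℝ] ℂ, (∀ a ∈ 𝔭, χ a = 0) →
        χ (quatPolyToQuat (f * y)).re = 0 ∧ χ (quatPolyToQuat (f * y)).imI = 0 ∧
        χ (quatPolyToQuat (f * y)).imJ = 0 ∧ χ (quatPolyToQuat (f * y)).imK = 0 := by
      intro χ hχ
      have h0 := hall χ hχ
      rw [matEval_quatEmbed_eq] at h0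
      have h00 := congrFun (congrFun h0 0) 0
      have h01 := congrFun (congrFun h0 0) 1
      have h10 := congrFun (congrFun h0 1) 0
      have h11 := congrFun (congrFun h0 1) 1
      simp only [Matrix.of_apply, Matrix.cons_val', Matrix.cons_val_zero, Matrix.cons_val_one,
        Matrix.cons_val_fin_one, Matrix.zero_apply] at h00 h01 h10 h11
      refine ⟨by linear_combination (h00 + h11) / 2, ?_, by linear_combination (h10 - h01) / 2, ?_⟩
      · exact (mul_eq_zero.1 (by linear_combination (h00 - h11) / 2 :
          Complex.I * χ (quatPolyToQuat (f * y)).imI = 0)).resolve_left hI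
      · exact (mul_eq_zero.1 (by linear_combination -(h10 + h01) / 2 :
          Complex.I * χ (quatPolyToQuat (f * y)).imK = 0)).resolve_left hI
    refine hfy ⟨?_, ?_, ?_, ?_⟩ <;> by_contra hp <;> obtain ⟨χ, h1, h2⟩ := hex _ hp
    exacts [h2 (hzero χ h1).1, h2 (hzero χ h1).2.1, h2 (hzero χ h1).2.2.1, h2 (hzero χ h1).2.2.2]
  obtain ⟨χ, hχ, hne⟩ := hχ
  set c : Fin d → ℂ := fun i => χ (MvPolynomial.X i) with hc
  rw [map_mul, matEval_mul] at hne
  -- Each column `w` of `φ(y)(c)` is killed by `φ(g i)(c)`, as `g i * y` has components in `𝔭`.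
  refine hne (Matrix.ext_of_mulVec_single fun j => ?_)
  rw [Matrix.zero_mulVec, ← Matrix.mulVec_mulVec]
  set w := (matEval c (quatEmbed d y)).mulVec (Pi.single j 1) with hw
  have hw' : w = ![w 0, w 1] := by ext i; fin_cases i <;> rfl
  rw [hw']
  refine h c _ _ fun i => ?_
  rw [← hw', hw, Matrix.mulVec_mulVec, ← matEval_mul, ← map_mul, hc, matEval_quatEmbed_eq]
  obtain ⟨h1, h2, h3, h4⟩ := hJy _ (hg i)
  rw [hχ _ h1, hχ _ h2, hχ _ h3, hχ _ h4]
  ext k; fin_cases k <;> fin_cases j <;> simp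

end QuaternionPolynomials

/-! ### Evaluation at good points -/

section Evaluation

variable {d : ℕ}

theorem list_prod_ofFn_mul {M : Type*} [Monoid M] {n : ℕ} (x y : Fin n → M)
    (h : ∀ i j, Commute (x i) (y j)) :
    (List.ofFn fun i => x i * y i).prod = (List.ofFn x).prod * (List.ofFn y).prod := by
  induction n with
  | zero => simp
  | succ n ih =>
    have hc : Commute (y 0) (List.ofFn fun i : Fin n => x i.succ).prod :=
      Commute.list_prod_right _ _ fun z hz => by
        obtain ⟨i, rfl⟩ := (List.mem_ofFn' _ _).1 hz
        exact (h _ _).symm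
    simp only [List.ofFn_succ, List.prod_cons]
    rw [ih _ _ fun i j => h _ _, mul_assoc, ← mul_assoc (y 0), hc.eq]
    simp only [mul_assoc]

theorem semiconjBy_list_prod_ofFn {M : Type*} [Monoid M] {n : ℕ} {w : M} {x y : Fin n → M}
    (h : ∀ i, SemiconjBy w (x i) (y i)) :
    SemiconjBy w (List.ofFn x).prod (List.ofFn y).prod := by
  induction n with
  | zero => simp
  | succ n ih =>
    simp only [List.ofFn_succ, List.prod_cons]
    exact (h 0).mul_right (ih fun i => h i.succ)

theorem quatEval_zero (a : Fin d → Quaternion ℝ) : quatEval a 0 = 0 := Finsupp.sum_zero_index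

theorem quatEval_add (a : Fin d → Quaternion ℝ) (f g : QuatPoly d) :
    quatEval a (f + g) = quatEval a f + quatEval a g :=
  Finsupp.sum_add_index' (fun _ => zero_mul _) fun _ _ _ => add_mul _ _ _

theorem quatEval_single (a : Fin d → Quaternion ℝ) (m : Fin d →₀ ℕ) (c : Quaternion ℝ) :
    quatEval a (AddMonoidAlgebra.single m c) = c * (List.ofFn fun i => a i ^ m i).prod :=
  Finsupp.sum_single_index (zero_mul _)

/-- Evaluation is not multiplicative: the value of the monomial ends up to the right of `f(a)`.
Goodness splits `a ^ (n + m)` as a product of ordered monomials. -/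
theorem quatEval_single_mul {a : Fin d → Quaternion ℝ} (ha : IsGoodPoint a) (m : Fin d →₀ ℕ)
    (c : Quaternion ℝ) (f : QuatPoly d) :
    quatEval a (AddMonoidAlgebra.single m c * f) =
      c * quatEval a f * (List.ofFn fun i => a i ^ m i).prod := by
  induction f using AddMonoidAlgebra.induction_linear with
  | zero => simp [quatEval_zero]
  | add f g hf hg => rw [mul_add, quatEval_add, hf, hg, quatEval_add]; noncomm_ring
  | single n e =>
    rw [AddMonoidAlgebra.single_mul_single, quatEval_single, quatEval_single, add_comm m n]
    simp only [Finsupp.add_apply, pow_add]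
    rw [list_prod_ofFn_mul _ _ fun i j => (show Commute (a i) (a j) from ha i j).pow_pow _ _]
    simp only [mul_assoc]

theorem quatEval_mul_of_eq_zero {a : Fin d → Quaternion ℝ} (ha : IsGoodPoint a) (g : QuatPoly d)
    {f : QuatPoly d} (hf : quatEval a f = 0) : quatEval a (g * f) = 0 := by
  induction g using AddMonoidAlgebra.induction_linear with
  | zero => rw [zero_mul, quatEval_zero]
  | add g h hg hh => rw [add_mul, quatEval_add, hg, hh, add_zero]
  | single m c => rw [quatEval_single_mul ha, hf, mul_zero, zero_mul]

theorem quatEval_mul_of_eq_one {a : Fin d → Quaternion ℝ} (ha : IsGoodPoint a) (g : QuatPoly d)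
    {f : QuatPoly d} (hf : quatEval a f = 1) : quatEval a (g * f) = quatEval a g := by
  induction g using AddMonoidAlgebra.induction_linear with
  | zero => rw [zero_mul]
  | add g h hg hh => rw [add_mul, quatEval_add, hg, hh, quatEval_add]
  | single m c => rw [quatEval_single_mul ha, hf, mul_one, quatEval_single]

theorem quatEval_quatConst_mul {a : Fin d → Quaternion ℝ} (ha : IsGoodPoint a) (b : Quaternion ℝ)
    (f : QuatPoly d) : quatEval a (quatConst b * f) = b * quatEval a f := by
  rw [quatConst, quatEval_single_mul ha]
  have : (List.ofFn fun i => a i ^ (0 : Fin d →₀ ℕ) i).prod = 1 :=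
    List.prod_eq_one fun x hx => by
      obtain ⟨i, rfl⟩ := (List.mem_ofFn' _ _).1 hx
      simp
  rw [this, mul_one]

/-- The left ideal of quaternionic polynomials that vanish at a good point. -/
def quatVanishing {a : Fin d → Quaternion ℝ} (ha : IsGoodPoint a) : Ideal (QuatPoly d) where
  carrier := {f | quatEval a f = 0}
  zero_mem' := quatEval_zero a
  add_mem' := fun {f g} hf hg => (quatEval_add a f g).trans (by rw [hf, hg, add_zero])
  smul_mem' := fun g _ hf => quatEval_mul_of_eq_zero ha g hf

theorem mem_quatVanishing {a : Fin d → Quaternion ℝ} {ha : IsGoodPoint a} {f : QuatPoly d} :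
    f ∈ quatVanishing ha ↔ quatEval a f = 0 := Iff.rfl

/-- If `f(a) ≠ 0`, the constant `b = f(a)⁻¹` makes `b f` take the value `1`, so `f b f` has the
nonzero value `f(a)`. -/
theorem isSemiprimeLeftIdeal_quatVanishing {a : Fin d → Quaternion ℝ} (ha : IsGoodPoint a) :
    IsSemiprimeLeftIdeal (quatVanishing ha) := by
  intro f hf
  by_contra hne
  rw [mem_quatVanishing] at hne
  have h1 : quatEval a (quatConst (quatEval a f)⁻¹ * f) = 1 := by
    rw [quatEval_quatConst_mul ha, inv_mul_cancel₀ hne]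
  have h2 := mem_quatVanishing.1 (hf (quatConst (quatEval a f)⁻¹))
  rw [mul_assoc, quatEval_mul_of_eq_one ha _ h1] at h2
  exact hne h2

/-- With `b = f(a)⁻¹`, right multiplication by powers of `b f` preserves values at `a`. The relation
would then give `1 = 0` there. -/
theorem quatEval_eq_zero_of_pow_mem {a : Fin d → Quaternion ℝ} (ha : IsGoodPoint a)
    {I : Ideal (QuatPoly d)} (hI : I ≤ quatVanishing ha) {f : QuatPoly d}
    (h : ∀ b : Quaternion ℝ, ∃ N : ℕ,
      (quatConst b * f) ^ N ∈ idealPowerSum I (quatConst b * f) N) : quatEval a f = 0 := by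
  by_contra hne
  obtain ⟨N, h', hh, hN⟩ := h (quatEval a f)⁻¹
  have h1 : quatEval a (quatConst (quatEval a f)⁻¹ * f) = 1 := by
    rw [quatEval_quatConst_mul ha, inv_mul_cancel₀ hne]
  set F := quatConst (quatEval a f)⁻¹ * f
  have hpow : ∀ (n : ℕ) (g : QuatPoly d), quatEval a (g * F ^ n) = quatEval a g := by
    intro n
    induction n with
    | zero => simp
    | succ n ih => intro g; rw [pow_succ, ← mul_assoc, quatEval_mul_of_eq_one ha _ h1, ih]
  have hmem : F ^ N ∈ quatVanishing ha := by
    rw [hN]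
    exact Submodule.sum_mem _ fun k _ => by
      rw [mem_quatVanishing, hpow]
      exact hI (hh k)
  rw [mem_quatVanishing] at hmem
  have hone : quatEval a (1 : QuatPoly d) = 1 := by
    have := quatEval_mul_of_eq_one ha 1 h1
    rw [one_mul, h1] at this
    exact this.symm
  have := hpow N 1
  rw [one_mul, hmem, hone] at this
  exact zero_ne_one this

theorem quatFst_coe (z : ℂ) : quatFst (z : Quaternion ℝ) = z := by
  apply Complex.ext <;> simp [quatFst]

theorem quatSnd_coe (z : ℂ) : quatSnd (z : Quaternion ℝ) = 0 := by
  apply Complex.ext <;> simp [quatSnd]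

theorem quatFst_quatJ_mul (z : ℂ) : quatFst (quatJ * (z : Quaternion ℝ)) = 0 := by
  rw [quatFst_mul, quatFst_coe, quatSnd_coe]
  have h : quatFst quatJ = 0 := rfl
  rw [h, zero_mul, mul_zero, sub_zero]

theorem quatSnd_quatJ_mul (z : ℂ) : quatSnd (quatJ * (z : Quaternion ℝ)) = z := by
  rw [quatSnd_mul, quatFst_coe, quatSnd_coe]
  have h : quatSnd quatJ = 1 := by apply Complex.ext <;> simp [quatSnd, quatJ]
  rw [h, one_mul, mul_zero, add_zero]

theorem quat_eq_zero_of_parts {x : Quaternion ℝ} (h1 : quatFst x = 0) (h2 : quatSnd x = 0) :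
    x = 0 := by
  rw [quat_eq_fst_add_j_mul_snd x, h1, h2]
  simp

/-- Evaluation at a good point that is conjugate by `w` to a complex point `c` corresponds to
evaluation of `φ` at `c` on the vector of complex coordinates of `w`. -/
theorem quatEval_mul_eq_mulVec {a : Fin d → Quaternion ℝ} {c : Fin d → ℂ} {w : Quaternion ℝ}
    (h : ∀ i, SemiconjBy w (c i : Quaternion ℝ) (a i)) (f : QuatPoly d) :
    ![quatFst (quatEval a f * w), quatSnd (quatEval a f * w)] =
      (matEval c (quatEmbed d f)).mulVec ![quatFst w, quatSnd w] := by
  induction f using AddMonoidAlgebra.induction_linear with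
  | zero =>
    rw [map_zero, ← matEvalHom_apply, map_zero, quatEval_zero, zero_mul, map_zero, map_zero,
      Matrix.zero_mulVec]
    ext i; fin_cases i <;> rfl
  | add f g hf hg =>
    rw [map_add, ← matEvalHom_apply, map_add, matEvalHom_apply, matEvalHom_apply,
      Matrix.add_mulVec, ← hf, ← hg, quatEval_add, add_mul, map_add, map_add]
    simp
  | single m z =>
    have h1 : SemiconjBy w ((∏ i, c i ^ m i : ℂ) : Quaternion ℝ)
        (List.ofFn fun i => a i ^ m i).prod := by
      have hc : ((∏ i, c i ^ m i : ℂ) : Quaternion ℝ) =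
          (List.ofFn fun i => (c i : Quaternion ℝ) ^ m i).prod := by
        rw [← List.prod_ofFn, ← Quaternion.coe_ofComplex, map_list_prod, List.map_ofFn]
        congr 2
        ext1 i
        exact map_pow Quaternion.ofComplex _ _
      rw [hc]
      exact semiconjBy_list_prod_ofFn fun i => (h i).pow_right (m i)
    rw [quatEval_single, mul_assoc, ← h1.eq, ← mul_assoc]
    generalize hP : (∏ i, c i ^ m i : ℂ) = P
    have hev : ∀ r : ℂ, MvPolynomial.eval c (MvPolynomial.monomial m r) = r * P := fun r => by
      rw [MvPolynomial.eval_monomial, ← hP, Finsupp.prod_fintype _ _ fun i => pow_zero _]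
    rw [quatFst_mul _ (P : Quaternion ℝ), quatSnd_mul _ (P : Quaternion ℝ), quatFst_coe,
      quatSnd_coe, quatFst_mul, quatSnd_mul]
    ext i; fin_cases i <;>
      simp [matEval, quatEmbed, polyFst_single, polySnd_single, polyConj, hev] <;> ring

theorem matEval_mulVec_eq_zero_of_forall_goodPoint {ι : Type*} {g : ι → QuatPoly d}
    {f : QuatPoly d}
    (h : ∀ a : Fin d → Quaternion ℝ, IsGoodPoint a →
      (∀ i, quatEval a (g i) = 0) → quatEval a f = 0)
    (c : Fin d → ℂ) (u v : ℂ)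
    (hg : ∀ i, (matEval c (quatEmbed d (g i))).mulVec ![u, v] = 0) :
    (matEval c (quatEmbed d f)).mulVec ![u, v] = 0 := by
  set w : Quaternion ℝ := (u : Quaternion ℝ) + quatJ * (v : Quaternion ℝ) with hw
  have hu : quatFst w = u := by rw [hw, map_add, quatFst_coe, quatFst_quatJ_mul, add_zero]
  have hv : quatSnd w = v := by rw [hw, map_add, quatSnd_coe, quatSnd_quatJ_mul, zero_add]
  by_cases hw0 : w = 0
  · rw [hw0, map_zero] at hu hv
    rw [← hu, ← hv]
    ext i; fin_cases i <;> simp [Matrix.mulVec, dotProduct]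
  -- Simultaneous conjugates of complex numbers commute, so this point is good.
  let a : Fin d → Quaternion ℝ := fun i => w * (c i : Quaternion ℝ) * w⁻¹
  have hsemi : ∀ i, SemiconjBy w (c i : Quaternion ℝ) (a i) := fun i => by
    simp [SemiconjBy, a, hw0]
  have ha : IsGoodPoint a := fun i j => by
    have hmul : ∀ i j, a i * a j = w * ((c i * c j : ℂ) : Quaternion ℝ) * w⁻¹ := fun i j => by
      simp only [a, Quaternion.coeComplex_mul]
      rw [mul_assoc (w * _) (w⁻¹), ← mul_assoc (w⁻¹), ← mul_assoc (w⁻¹), inv_mul_cancel₀ hw0,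
        one_mul]
      simp only [mul_assoc]
    rw [hmul, hmul, mul_comm]
  have hfa : quatEval a f = 0 := h a ha fun i => by
    have := quatEval_mul_eq_mulVec hsemi (g i)
    rw [hu, hv, hg i] at this
    exact (mul_eq_zero.1 (quat_eq_zero_of_parts (congrFun this 0) (congrFun this 1))).resolve_right
      hw0
  have := quatEval_mul_eq_mulVec hsemi f
  rw [hu, hv, hfa, zero_mul, map_zero, map_zero] at this
  rw [← this]
  ext i; fin_cases i <;> rfl

end Evaluation

/-! ### Matrix polynomials as the complexification of quaternionic polynomials -/

section Complexification

variable {d : ℕ}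

local notation "M₂[" d "]" => Matrix (Fin 2) (Fin 2) (MvPolynomial (Fin d) ℂ)

theorem quatEmbed_injective : Function.Injective (quatEmbed d) := by
  intro f g h
  have h1 : polyFst f = polyFst g := congrFun (congrFun h 0) 0
  have h2 : polySnd f = polySnd g := congrFun (congrFun h 1) 0
  refine AddMonoidAlgebra.ext (Finsupp.ext fun m => sub_eq_zero.1 (quat_eq_zero_of_parts ?_ ?_))
  · rw [map_sub, sub_eq_zero]
    exact congrArg (MvPolynomial.coeff m) h1
  · rw [map_sub, sub_eq_zero]
    exact congrArg (MvPolynomial.coeff m) h2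

theorem exists_polyFst_polySnd (p q : MvPolynomial (Fin d) ℂ) :
    ∃ f : QuatPoly d, polyFst f = p ∧ polySnd f = q := by
  refine ⟨AddMonoidAlgebra.ofCoeff (Finsupp.onFinset (p.support ∪ q.support)
    (fun m => ((p.coeff m : ℂ) : Quaternion ℝ) + quatJ * ((q.coeff m : ℂ) : Quaternion ℝ)) ?_), ?_, ?_⟩
  · intro m hm
    contrapose! hm
    simp only [Finset.mem_union, MvPolynomial.mem_support_iff, not_or, not_not] at hm
    rw [hm.1, hm.2]
    simp
  · refine MvPolynomial.ext _ _ fun m => ?_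
    change quatFst (_ + _) = _
    rw [map_add, quatFst_coe, quatFst_quatJ_mul, add_zero]
  · refine MvPolynomial.ext _ _ fun m => ?_
    change quatSnd (_ + _) = _
    rw [map_add, quatSnd_coe, quatSnd_quatJ_mul, zero_add]

/-- The antilinear involution of `M₂(ℂ[x₁, …, x_d])` whose fixed ring is the image of `φ`. -/
noncomputable def matConj (F : M₂[d]) : M₂[d] :=
  !![polyConj (F 1 1), -polyConj (F 1 0); -polyConj (F 0 1), polyConj (F 0 0)]

theorem matConj_add (F G : M₂[d]) : matConj (F + G) = matConj F + matConj G := by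
  ext1 i j; fin_cases i <;> fin_cases j <;> simp [matConj] <;> ring

theorem matConj_mul (F G : M₂[d]) : matConj (F * G) = matConj F * matConj G := by
  ext1 i j; fin_cases i <;> fin_cases j <;>
    simp [matConj, Matrix.mul_apply, Fin.sum_univ_two] <;> ring

theorem polyConj_smul (z : ℂ) (p : MvPolynomial (Fin d) ℂ) :
    polyConj (z • p) = (starRingEnd ℂ z) • polyConj p := by
  rw [MvPolynomial.smul_eq_C_mul, MvPolynomial.smul_eq_C_mul, map_mul, polyConj,
    MvPolynomial.map_C]

theorem matConj_smul (z : ℂ) (F : M₂[d]) : matConj (z • F) = (starRingEnd ℂ z) • matConj F := by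
  ext1 i j; fin_cases i <;> fin_cases j <;> simp [matConj, polyConj_smul]

theorem matConj_quatEmbed (f : QuatPoly d) : matConj (quatEmbed d f) = quatEmbed d f := by
  ext1 i j; fin_cases i <;> fin_cases j <;> simp [matConj, quatEmbed, polyConj_polyConj]

theorem exists_quatEmbed_eq_average (F : M₂[d]) :
    ∃ f : QuatPoly d, quatEmbed d f = (1 / 2 : ℂ) • (F + matConj F) := by
  obtain ⟨f, hp, hq⟩ := exists_polyFst_polySnd ((1 / 2 : ℂ) • (F 0 0 + polyConj (F 1 1)))
    ((1 / 2 : ℂ) • (F 1 0 - polyConj (F 0 1)))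
  have h2 : starRingEnd ℂ 2 = 2 := map_ofNat _ 2
  refine ⟨f, ?_⟩
  ext1 i j; fin_cases i <;> fin_cases j <;>
    simp [quatEmbed, hp, hq, matConj, polyConj_smul, polyConj_polyConj, sub_eq_add_neg,
      add_comm, h2]

/-- The projection of `M₂(ℂ[x₁, …, x_d])` onto `ℍ[x₁, …, x_d]`. -/
noncomputable def matToQuat (F : M₂[d]) : QuatPoly d := (exists_quatEmbed_eq_average F).choose

theorem quatEmbed_matToQuat (F : M₂[d]) :
    quatEmbed d (matToQuat F) = (1 / 2 : ℂ) • (F + matConj F) :=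
  (exists_quatEmbed_eq_average F).choose_spec

theorem matToQuat_add (F G : M₂[d]) : matToQuat (F + G) = matToQuat F + matToQuat G := by
  apply quatEmbed_injective
  rw [map_add, quatEmbed_matToQuat, quatEmbed_matToQuat, quatEmbed_matToQuat, matConj_add]
  module

theorem matToQuat_mul_quatEmbed (F : M₂[d]) (g : QuatPoly d) :
    matToQuat (F * quatEmbed d g) = matToQuat F * g := by
  apply quatEmbed_injective
  rw [map_mul, quatEmbed_matToQuat, quatEmbed_matToQuat, matConj_mul, matConj_quatEmbed,
    smul_mul_assoc, add_mul]

theorem matToQuat_quatEmbed (g : QuatPoly d) : matToQuat (quatEmbed d g) = g := by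
  apply quatEmbed_injective
  rw [quatEmbed_matToQuat, matConj_quatEmbed]
  module

theorem eq_quatEmbed_add_I_smul (F : M₂[d]) :
    F = quatEmbed d (matToQuat F) +
      Complex.I • quatEmbed d (matToQuat ((-Complex.I) • F)) := by
  rw [quatEmbed_matToQuat, quatEmbed_matToQuat, matConj_smul, map_neg, Complex.conj_I, neg_neg,
    smul_smul, smul_add, smul_add, smul_smul, smul_smul]
  have h : Complex.I * (1 / 2) * -Complex.I = 1 / 2 := by linear_combination -Complex.I_sq / 2
  have h' : Complex.I * (1 / 2) * Complex.I = -1 / 2 := by linear_combination Complex.I_sq / 2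
  rw [h, h']
  module

/-- Every matrix polynomial is `φ(x) + i φ(y)` with `i` central, so testing against the image of `φ`
suffices. -/
theorem isSemiprimeLeftIdeal_comap_quatEmbed {J : Ideal M₂[d]} (hJ : IsSemiprimeLeftIdeal J) :
    IsSemiprimeLeftIdeal (J.comap (quatEmbed d)) := by
  intro a ha
  have ha' : ∀ x, quatEmbed d a * quatEmbed d x * quatEmbed d a ∈ J := fun x => by
    rw [← map_mul, ← map_mul]
    exact ha x
  refine hJ _ fun F => ?_
  rw [eq_quatEmbed_add_I_smul F, mul_add, add_mul, mul_smul_comm, smul_mul_assoc]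
  refine J.add_mem (ha' _) ?_
  rw [← one_mul (quatEmbed d a * _ * _), ← smul_mul_assoc]
  exact J.mul_mem_left _ (ha' _)

theorem matToQuat_mem_span {ι : Type*} {g : ι → QuatPoly d} {F : M₂[d]}
    (hF : F ∈ Ideal.span (Set.range fun i => quatEmbed d (g i))) :
    matToQuat F ∈ Ideal.span (Set.range g) := by
  -- The projection is not linear over matrices on the left, so the induction needs an arbitrary
  -- left factor `G`.
  suffices h : ∀ G : M₂[d], matToQuat (G * F) ∈ Ideal.span (Set.range g) by
    simpa using h 1
  induction hF using Submodule.span_induction with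
  | mem F hF =>
    obtain ⟨i, rfl⟩ := hF
    intro G
    rw [matToQuat_mul_quatEmbed]
    exact Ideal.mul_mem_left _ _ (Ideal.subset_span ⟨i, rfl⟩)
  | zero =>
    intro G
    have := matToQuat_quatEmbed (0 : QuatPoly d)
    rw [map_zero] at this
    rw [mul_zero, this]
    exact zero_mem _
  | add F F' _ _ hF hF' =>
    intro G
    rw [mul_add, matToQuat_add]
    exact add_mem (hF G) (hF' G)
  | smul H F _ hF =>
    intro G
    rw [smul_eq_mul, ← mul_assoc]
    exact hF _

theorem quatEmbed_quatConst (b : Quaternion ℝ) : quatEmbed d (quatConst b) =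
    matConst !![quatFst b, -starRingEnd ℂ (quatSnd b); quatSnd b, starRingEnd ℂ (quatFst b)] := by
  ext1 i j; fin_cases i <;> fin_cases j <;>
    simp [quatEmbed, quatConst, matConst, polyFst_single, polySnd_single, polyConj,
      ← MvPolynomial.C_apply]

/-- Take for `A` the matrix of `b` and project the relation: `matToQuat` is right `ℍ[x]`-linear,
inverts `φ` on its image and carries `I'` into `I`. -/
theorem quatPow_mem_of_matPow_mem {ι : Type*} {g : ι → QuatPoly d} {f : QuatPoly d}
    (h : ∀ A : Matrix (Fin 2) (Fin 2) ℂ, ∃ N : ℕ, (matConst A * quatEmbed d f) ^ N ∈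
      idealPowerSum (Ideal.span (Set.range fun i => quatEmbed d (g i)))
        (matConst A * quatEmbed d f) N) (b : Quaternion ℝ) :
    ∃ N : ℕ, (quatConst b * f) ^ N ∈
      idealPowerSum (Ideal.span (Set.range g)) (quatConst b * f) N := by
  obtain ⟨N, p, hp, hN⟩ := h _
  rw [← quatEmbed_quatConst b, ← map_mul] at hN
  refine ⟨N, fun k => matToQuat (p k), fun k => matToQuat_mem_span (hp k), ?_⟩
  let π : M₂[d] →+ QuatPoly d := AddMonoidHom.mk' matToQuat matToQuat_add
  have := congrArg π hN
  rw [map_sum, ← map_pow] at this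
  simp only [← map_pow] at this
  simpa only [π, AddMonoidHom.mk'_apply, matToQuat_quatEmbed, matToQuat_mul_quatEmbed] using this

/-- The left ideal of matrix polynomials whose value at `c` annihilates the vector `w`. -/
noncomputable def matVanishing (c : Fin d → ℂ) (w : Fin 2 → ℂ) : Ideal M₂[d] where
  carrier := {F | (matEval c F).mulVec w = 0}
  zero_mem' := by
    change (matEvalHom c 0).mulVec w = 0
    rw [map_zero, Matrix.zero_mulVec]
  add_mem' := fun {F G} hF hG => by
    change (matEvalHom c (F + G)).mulVec w = 0
    rw [map_add, Matrix.add_mulVec, matEvalHom_apply, matEvalHom_apply, hF, hG, add_zero]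
  smul_mem' := fun G F hF => by
    change (matEval c (G * F)).mulVec w = 0
    rw [matEval_mul, ← Matrix.mulVec_mulVec, hF, Matrix.mulVec_zero]

theorem mem_matVanishing {c : Fin d → ℂ} {w : Fin 2 → ℂ} {F : M₂[d]} :
    F ∈ matVanishing c w ↔ (matEval c F).mulVec w = 0 := Iff.rfl

theorem matEval_matConst (c : Fin d → ℂ) (A : Matrix (Fin 2) (Fin 2) ℂ) :
    matEval c (matConst A) = A := by
  ext i j
  simp [matEval, matConst]

theorem isSemiprimeLeftIdeal_matVanishing (c : Fin d → ℂ) (w : Fin 2 → ℂ) :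
    IsSemiprimeLeftIdeal (matVanishing c w) := by
  intro F hF
  by_contra hne
  rw [mem_matVanishing] at hne
  obtain ⟨i, hi⟩ := Function.ne_iff.1 hne
  set z := (matEval c F).mulVec w with hz
  -- The rank-one constant matrix sends `z = F(c) w` back to `w`, so the product sends `w` to `z ≠
  -- 0`.
  have h := mem_matVanishing.1 (hF (matConst (Matrix.vecMulVec w (Pi.single i (z i)⁻¹))))
  rw [matEval_mul, matEval_mul, matEval_matConst, ← Matrix.mulVec_mulVec, ← hz,
    ← Matrix.mulVec_mulVec, Matrix.vecMulVec_mulVec] at h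
  have h1 : Pi.single i (z i)⁻¹ ⬝ᵥ z = 1 := by
    rw [single_dotProduct, inv_mul_cancel₀ hi]
  rw [h1] at h
  rw [MulOpposite.op_one, one_smul] at h
  exact hne h

end Complexification

/-! ### Powers modulo a left ideal and eigenvalues on its kernel vectors -/

section PowerMembership

open Polynomial

/-- The value of `r * p` is `∑ rₙ p(x) xⁿ`, which depends on `p` only through `p(x)`. This makes
`evalIdeal` a left ideal. -/
theorem eval_mul_congr {A : Type*} [Ring A] {x : A} {p q : A[X]} (h : p.eval x = q.eval x)
    (r : A[X]) : (r * p).eval x = (r * q).eval x := by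
  induction r using Polynomial.induction_on' with
  | add r s hr hs => rw [add_mul, add_mul, eval_add, eval_add, hr, hs]
  | monomial n a =>
    rw [← C_mul_X_pow_eq_monomial, mul_assoc, mul_assoc, X_pow_mul, X_pow_mul, eval_C_mul,
      eval_C_mul, eval_mul_X_pow, eval_mul_X_pow, h]

/-- The left ideal of polynomials whose value at `x` is the value of a polynomial with
coefficients in `I`. -/
def evalIdeal {A : Type*} [Ring A] (I : Ideal A) (x : A) : Ideal A[X] where
  carrier := {p | ∃ q : A[X], (∀ k, q.coeff k ∈ I) ∧ p.eval x = q.eval x}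
  zero_mem' := ⟨0, by simp, rfl⟩
  add_mem' := by
    rintro p p' ⟨q, hq, h⟩ ⟨q', hq', h'⟩
    exact ⟨q + q', fun k => by rw [coeff_add]; exact I.add_mem (hq k) (hq' k),
      by rw [eval_add, eval_add, h, h']⟩
  smul_mem' := by
    rintro r p ⟨q, hq, h⟩
    refine ⟨r * q, fun k => ?_, eval_mul_congr h r⟩
    rw [coeff_mul]
    exact I.sum_mem fun _ _ => I.mul_mem_left _ (hq _)

theorem exists_pow_mem_idealPowerSum {A : Type*} [Ring A] {I : Ideal A} {x : A} {n : ℕ}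
    (h : (X : A[X]) ^ n ∈ evalIdeal I x) : ∃ N, x ^ N ∈ idealPowerSum I x N := by
  obtain ⟨q, hq, h⟩ := h
  rw [eval_X_pow] at h
  -- Multiplying `x ^ n = q(x)` on the left by `x ^ q.natDegree` raises the exponent above the
  -- degree of `q` and keeps the coefficients in `I`.
  refine ⟨n + q.natDegree, fun k => x ^ q.natDegree * q.coeff k,
    fun k => I.mul_mem_left _ (hq k), ?_⟩
  rw [add_comm, pow_add, h, eval_eq_sum_range' (n := q.natDegree + n + 1) (by lia),
    Finset.mul_sum]
  simp only [mul_assoc]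

/-- If every eigenvalue of `F`, at every point of the spectrum and on vectors annihilated by
the left ideal `I`, is zero, then a power of `F` lies in `I + I F + ⋯ + I F ^ N`. -/
theorem exists_matPow_mem_of_eigenvalue_eq_zero {K R : Type*} [Field K] [IsAlgClosed K]
    [CommRing R] [Algebra K R] [Algebra.FiniteType K R] (I : Ideal (Matrix (Fin 2) (Fin 2) R))
    (F : Matrix (Fin 2) (Fin 2) R)
    (h : ∀ (χ : R →ₐ[K] K) (w : Fin 2 → K), w ≠ 0 → (∀ z ∈ I, (z.map χ).mulVec w = 0) →
      ∀ t : K, (F.map χ).mulVec w = t • w → t = 0) :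
    ∃ N, F ^ N ∈ idealPowerSum I F N := by
  let e : Matrix (Fin 2) (Fin 2) R[X] →+* (Matrix (Fin 2) (Fin 2) R)[X] :=
    (matPolyEquiv : Matrix (Fin 2) (Fin 2) R[X] ≃ₐ[R] _).toRingEquiv.toRingHom
  have he : ∀ Z, e Z = matPolyEquiv Z := fun _ => rfl
  let L : Ideal (Matrix (Fin 2) (Fin 2) R[X]) := (evalIdeal I F).comap e
  -- The scalars in `L`; a power of `X` in `𝔡` is exactly what `exists_pow_mem_idealPowerSum` needs.
  let 𝔡 : Ideal R[X] := L.comap (Matrix.scalar (Fin 2))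
  by_cases hX : (X : R[X]) ∈ 𝔡.radical
  · obtain ⟨n, hn⟩ := hX
    refine exists_pow_mem_idealPowerSum (n := n) ?_
    have h1 : e (Matrix.scalar (Fin 2) (X ^ n)) ∈ evalIdeal I F := hn
    rwa [map_pow, map_pow, he, Matrix.scalar_apply, matPolyEquiv_diagonal_X] at h1
  exfalso
  obtain ⟨χ, hχ, hχX⟩ := exists_algHom_of_notMem_radical (k := K) (K := K) hX
  let ψ : Matrix (Fin 2) (Fin 2) R[X] →+* Matrix (Fin 2) (Fin 2) K := χ.toRingHom.mapMatrix
  have hψ : ∀ Z, ψ Z = Z.map χ := fun _ => rfl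
  have hsurj : Function.Surjective ψ := fun Z =>
    ⟨Z.map (algebraMap K R[X]), by ext i j; exact χ.commutes _⟩
  obtain ⟨w, hw, hLw⟩ := exists_common_kernel_vector (L.map ψ) (fun z hz => by
    obtain ⟨y, hy, rfl⟩ := (Ideal.mem_map_iff_of_surjective ψ hsurj).1 hz
    -- The adjugate puts determinants of elements of `L` into `𝔡`, so `χ` maps `L` to singular
    -- matrices.
    have hdet : y.det ∈ 𝔡 := by
      have := L.mul_mem_left y.adjugate hy
      rw [Matrix.adjugate_mul] at this
      rwa [Ideal.mem_comap, Matrix.scalar_apply, ← Matrix.smul_one_eq_diagonal]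
    exact (χ.toRingHom.map_det y).symm.trans (hχ _ hdet))
  replace hLw : ∀ z ∈ L, (z.map χ).mulVec w = 0 := fun z hz => hLw _ (Ideal.mem_map_of_mem ψ hz)
  refine hχX (h (χ.comp (Algebra.ofId R R[X] |>.restrictScalars K)) w hw (fun z hz => ?_) _ ?_)
  · have hzL : z.map C ∈ L := by
      rw [Ideal.mem_comap, he, matPolyEquiv_map_C]
      exact ⟨C z, fun k => by rw [coeff_C]; split_ifs; exacts [hz, I.zero_mem], rfl⟩
    have := hLw _ hzL
    rw [Matrix.map_map] at this
    exact this
  -- The matrix `X - F` has value `0` at `F`, so it lies in `L`; hence `w` is an eigenvector with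
  -- eigenvalue `χ X ≠ 0`.
  · have hc : Matrix.charmatrix F ∈ L := by
      rw [Ideal.mem_comap, he, Matrix.matPolyEquiv_charmatrix]
      exact ⟨0, by simp, by simp⟩
    have := hLw _ hc
    have hmap : (Matrix.charmatrix F).map χ = χ X • (1 : Matrix (Fin 2) (Fin 2) K) -
        F.map (χ.comp (Algebra.ofId R R[X] |>.restrictScalars K)) := by
      ext i j
      by_cases hij : i = j
      · subst hij
        simp [Matrix.charmatrix_apply_eq, Algebra.ofId_apply]
      · simp [Algebra.ofId_apply, hij]
    rw [hmap, Matrix.sub_mulVec, Matrix.smul_mulVec, Matrix.one_mulVec, sub_eq_zero] at this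
    exact this.symm

end PowerMembership

/-! ### The equivalences -/

theorem exists_matPow_mem_of_forall_matEval {d m : ℕ} {g : Fin m → QuatPoly d} {f : QuatPoly d}
    (h : ∀ (c : Fin d → ℂ) (u v : ℂ),
      (∀ i, (matEval c (quatEmbed d (g i))).mulVec ![u, v] = 0) →
        (matEval c (quatEmbed d f)).mulVec ![u, v] = 0)
    (A : Matrix (Fin 2) (Fin 2) ℂ) :
    ∃ N : ℕ, (matConst A * quatEmbed d f) ^ N ∈
      idealPowerSum (Ideal.span (Set.range fun i => quatEmbed d (g i)))
        (matConst A * quatEmbed d f) N := by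
  refine exists_matPow_mem_of_eigenvalue_eq_zero (K := ℂ) _ _ fun χ w hw hI t ht => ?_
  have hχ : ∀ F : Matrix (Fin 2) (Fin 2) (MvPolynomial (Fin d) ℂ),
      F.map χ = matEval (fun i => χ (MvPolynomial.X i)) F := fun F => by
    ext i j
    exact (DFunLike.congr_fun (MvPolynomial.aeval_unique χ) (F i j)).trans
      (DFunLike.congr_fun (MvPolynomial.coe_aeval_eq_eval _) (F i j))
  have hw' : w = ![w 0, w 1] := by ext i; fin_cases i <;> rfl
  have hf := h (fun i => χ (MvPolynomial.X i)) (w 0) (w 1) fun i => by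
    rw [← hw', ← hχ]
    exact hI _ (Ideal.subset_span ⟨i, rfl⟩)
  -- By hypothesis `φ(f)(c)` already kills `w`, whatever `A` is, so `t • w = 0`.
  rw [hχ, matEval_mul, ← Matrix.mulVec_mulVec, hw', hf, Matrix.mulVec_zero, ← hw'] at ht
  exact (smul_eq_zero.1 ht.symm).resolve_right hw

theorem theorem6p3 {d m : ℕ} (g : Fin m → QuatPoly d) (f : QuatPoly d)
    (I : Ideal (QuatPoly d)) (hI : I = Ideal.span (Set.range g))
    (I' : Ideal (Matrix (Fin 2) (Fin 2) (MvPolynomial (Fin d) ℂ)))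
    (hI' : I' = Ideal.span (Set.range fun i => quatEmbed d (g i))) :
    List.TFAE [
      ∀ a : Fin d → Quaternion ℝ, IsGoodPoint a →
        (∀ i, quatEval a (g i) = 0) → quatEval a f = 0,
      ∀ (c : Fin d → ℂ) (u v : ℂ),
        (∀ i, (matEval c (quatEmbed d (g i))).mulVec ![u, v] = 0) →
          (matEval c (quatEmbed d f)).mulVec ![u, v] = 0,
      quatEmbed d f ∈ semiprimeClosure I',
      f ∈ semiprimeClosure I,
      ∀ A : Matrix (Fin 2) (Fin 2) ℂ, ∃ N : ℕ,
        (matConst A * quatEmbed d f) ^ N ∈ idealPowerSum I' (matConst A * quatEmbed d f) N,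
      ∀ b : Quaternion ℝ, ∃ N : ℕ,
        (quatConst b * f) ^ N ∈ idealPowerSum I (quatConst b * f) N] := by
  subst hI hI'
  have hspan : ∀ {a : Fin d → Quaternion ℝ} (ha : IsGoodPoint a), (∀ i, quatEval a (g i) = 0) →
      Ideal.span (Set.range g) ≤ quatVanishing ha := fun ha hg =>
    Ideal.span_le.2 (Set.range_subset_iff.2 hg)
  tfae_have 1 → 2 := matEval_mulVec_eq_zero_of_forall_goodPoint
  tfae_have 2 → 4 := fun h => (Submodule.mem_sInf).2 fun J hJ =>
    mem_semiprime_of_forall_matEval h hJ.2 fun i => hJ.1 (Ideal.subset_span ⟨i, rfl⟩)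
  tfae_have 4 → 1 := fun h a ha hg => (isLeast_semiprimeClosure _).2
    ⟨hspan ha hg, isSemiprimeLeftIdeal_quatVanishing ha⟩ h
  tfae_have 4 → 3 := fun h => (Submodule.mem_sInf).2 fun J hJ =>
    have hle : Ideal.span (Set.range g) ≤ Ideal.comap (quatEmbed d) J :=
      Ideal.span_le.2 (Set.range_subset_iff.2 fun i => hJ.1 (Ideal.subset_span ⟨i, rfl⟩))
    (isLeast_semiprimeClosure _).2 ⟨hle, isSemiprimeLeftIdeal_comap_quatEmbed hJ.2⟩ h
  tfae_have 3 → 2 := fun h c u v hg => (isLeast_semiprimeClosure _).2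
    ⟨Ideal.span_le.2 (Set.range_subset_iff.2 hg), isSemiprimeLeftIdeal_matVanishing c _⟩ h
  tfae_have 2 → 5 := exists_matPow_mem_of_forall_matEval
  tfae_have 5 → 6 := quatPow_mem_of_matPow_mem
  tfae_have 6 → 1 := fun h a ha hg => quatEval_eq_zero_of_pow_mem ha (hspan ha hg) h
  tfae_finish
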